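/- **Theorem 6.3** (the $\Gamma(1)$-transformation law for the general $\theta$-function). For integers $\alpha,\beta$, and for $z,\tau\in\mathbb C$ with $\operatorname{Im}\tau>0$, let $$\theta\!\left[{\alpha\atop\beta}\right](z|\tau)=\sum_{k=-\infty}^{\infty}e^{\pi i(k+\frac{\alpha}{2})^2\tau+2\pi i(k+\frac{\alpha}{2})(z+\frac{\beta}{2})}.$$ Then for all integers $\alpha,\beta,n$ and all $z,\tau\in\mathbb C$ with $\operatorname{Im}\tau>0$, $$\theta\!\left[{\alpha-1\atop\beta-1}\right](z|\tau+n)=i^{\frac n2(1-\alpha^2)}\;\theta\!\left[{\alpha-1\atop\beta+n\alpha-1}\right](z|\tau),\qquad i^{x}:=e^{\pi i x/2}.$$ Moreover, for all integers $a,b,c,d$ with $ad-bc=1$ and $c>0$, $$\theta\!\left[{\alpha'-1\atop\beta'-1}\right]\!\left(\frac{z}{c\tau+d}\,\middle|\,\frac{a\tau+b}{c\tau+d}\right)=\mathfrak E_{\alpha\beta}\,\mathfrak N^3\,\sqrt{c\tau+d}\;e^{\frac{\pi i c z^2}{c\tau+d}}\;\theta\!\left[{\alpha-1\atop\beta-1}\right](z|\tau),$$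 where the square root is the principal one, the characteristics are related by the linear transformation $$\alpha'=d\alpha-c\beta,\quad \beta'=-b\alpha+a\beta,\qquad\text{and inversely}\qquad \alpha=a\alpha'+c\beta',\quad \beta=b\alpha'+d\beta',$$ and the multipliers are $$\mathfrak E_{\alpha\beta}=\exp\frac{\pi i}{4}\Bigl\{2\alpha(\beta bc-d+1)-\beta c(\beta a-2)-\alpha^2db\Bigr\},$$ $$\mathfrak N=\exp\pi i\left\{\frac{a-d}{12c}-\frac d6(2c-3)+\frac{c-1}{4}\operatorname{sign}(d)-\frac14+\frac1c\sum_{k=\lfloor c/d\rfloor+1}^{c-1}\left[\frac dc k\right]k\right\}.$$ Here $[x]$ denotes the integer part of $x$ (rounding towards zero), $\operatorname{sign}(0)=0$, an empty sum is $0$, and for $d=0$ (hence $c=1$) the sum is $0$. -/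

import Mathlib

/-- The theta series with integer characteristics `α, β`:
`θ[α, β](z | τ) = ∑_{k ∈ ℤ} exp (π i (k + α/2)² τ + 2 π i (k + α/2) (z + β/2))`.
It converges absolutely for `0 < Im τ`, see `summable_theta`. -/
noncomputable def theta (α β : ℤ) (z τ : ℂ) : ℂ :=
  ∑' k : ℤ, Complex.exp (Real.pi * Complex.I * ((k : ℂ) + (α : ℂ) / 2) ^ 2 * τ
    + 2 * Real.pi * Complex.I * ((k : ℂ) + (α : ℂ) / 2) * (z + (β : ℂ) / 2))

theorem summable_theta (α β : ℤ) (z τ : ℂ) (hτ : 0 < τ.im) :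
    Summable (fun k : ℤ =>
      Complex.exp (Real.pi * Complex.I * ((k : ℂ) + (α : ℂ) / 2) ^ 2 * τ
        + 2 * Real.pi * Complex.I * ((k : ℂ) + (α : ℂ) / 2) * (z + (β : ℂ) / 2))) := by
  have h := ((summable_jacobiTheta₂_term_iff (z + β / 2 + α * τ / 2) τ).2 hτ).mul_left
    (Complex.exp (Real.pi * Complex.I * (α / 2) ^ 2 * τ
      + 2 * Real.pi * Complex.I * (α / 2) * (z + β / 2)))
  refine h.congr fun k => ?_
  rw [jacobiTheta₂_term, ← Complex.exp_add]
  congr 1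
  ring

/-- The integer part `[x]` of a rational number: the fractional digits are dropped, that is,
`x` is rounded towards zero. -/
noncomputable def integerPart (x : ℚ) : ℤ := if 0 ≤ x then ⌊x⌋ else ⌈x⌉

/-- The Dedekind-type sum `∑_{k = ⌊c/d⌋ + 1}^{c - 1} [d k / c] k`. It is `0` when the range is empty
or when `d = 0` (all its terms contain the factor `[0] = 0` then). -/
noncomputable def dedekindTypeSum (c d : ℤ) : ℤ :=
  ∑ k ∈ Finset.Icc (⌊(c : ℚ) / (d : ℚ)⌋ + 1) (c - 1),
    integerPart ((d : ℚ) / (c : ℚ) * (k : ℚ)) * k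

/-- The rational number whose exponential `exp (π i ·)` is the multiplier `N`. -/
noncomputable def multiplierExponent (a c d : ℤ) : ℚ :=
  ((a : ℚ) - d) / (12 * c) - (d : ℚ) / 6 * (2 * c - 3) + ((c : ℚ) - 1) / 4 * (Int.sign d : ℚ)
    - 1 / 4 + 1 / (c : ℚ) * (dedekindTypeSum c d : ℚ)

/-- The multiplier `N`, for a matrix with rows `(a, b)` and `(c, d)`. -/
noncomputable def multiplierN (a c d : ℤ) : ℂ :=
  Complex.exp (Real.pi * Complex.I * ((multiplierExponent a c d : ℚ) : ℂ))

/-- The multiplier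
`E_{αβ} = exp ((π i / 4) (2 α (β b c - d + 1) - β c (β a - 2) - α² d b))`. -/
noncomputable def multiplierE (a b c d α β : ℤ) : ℂ :=
  Complex.exp (Real.pi / 4 * Complex.I *
    ((2 * α * (β * b * c - d + 1) - β * c * (β * a - 2) - α ^ 2 * d * b : ℤ) : ℂ))

/-! Shifting `z` by a half-period absorbs the characteristic into an exponential factor, so
everything reduces to the odd function `theta (-1) (-1)`. Its behaviour under τ ↦ τ + n is a phase
computed term by term; under τ ↦ -1/τ it follows from the functional equation of `jacobiTheta₂`. A
general matrix is reached by the Euclidean algorithm on (c, d), run as strong induction on c in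
`theta_neg_one_modular`: a translation brings d into [0, c), an inversion replaces (c, d) by (d,
-c). The accumulated phase has a closed form in `residueSum d c`: periodicity in d handles the
translations, and `residueSum_reciprocity` handles the inversions. `multiplierExponent_eq`
identifies this closed form with the multiplier, and `Complex.cpow_half_mul_cpow_half` controls the
branch of the square root. -/

/-! ### Translation, parity and inversion of theta. -/

theorem theta_add_int (α β n : ℤ) (z τ : ℂ) :
    theta (α - 1) (β - 1) z (τ + n) =
      Complex.I ^ ((n : ℂ) / 2 * (1 - (α : ℂ) ^ 2)) * theta (α - 1) (β + n * α - 1) z τ := by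
  rw [theta, theta, ← tsum_mul_left]
  refine tsum_congr fun k => ?_
  rw [Complex.cpow_def_of_ne_zero Complex.I_ne_zero, Complex.log_I, ← Complex.exp_add,
    Complex.exp_eq_exp_iff_exists_int]
  obtain ⟨m, hm⟩ := Int.even_mul_pred_self k
  have hm' : (k : ℂ) * (k - 1) = m + m := by exact_mod_cast hm
  -- The exponents of the k-th terms differ by πi n k(k - 1) = 2πi n m.
  refine ⟨n * m, ?_⟩
  push_cast
  linear_combination (Real.pi * Complex.I * n) * hm'

theorem theta_eq_exp_mul_theta_neg_one (α β : ℤ) (z τ : ℂ) :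
    theta (α - 1) (β - 1) z τ =
      Complex.exp (Real.pi * Complex.I * (α ^ 2 * τ / 4 + α * (z + (β - 1) / 2))) *
        theta (-1) (-1) (z + α * τ / 2 + β / 2) τ := by
  rw [theta, theta, ← tsum_mul_left]
  refine tsum_congr fun k => ?_
  rw [← Complex.exp_add]
  congr 1
  push_cast
  ring

theorem theta_neg_one_eq_jacobiTheta₂ (z τ : ℂ) :
    theta (-1) (-1) z τ =
      Complex.exp (Real.pi * Complex.I * (τ / 4 - z + 1 / 2)) *
        jacobiTheta₂ (z - 1 / 2 - τ / 2) τ := by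
  rw [theta, jacobiTheta₂, ← tsum_mul_left]
  refine tsum_congr fun k => ?_
  rw [jacobiTheta₂_term, ← Complex.exp_add]
  congr 1
  push_cast
  ring

theorem theta_neg_one_add_int (n : ℤ) (z τ : ℂ) :
    theta (-1) (-1) z (τ + n) =
      Complex.exp (Real.pi * Complex.I * (n / 4)) * theta (-1) (-1) z τ := by
  have h := theta_add_int 0 0 n z τ
  rw [Complex.cpow_def_of_ne_zero Complex.I_ne_zero, Complex.log_I] at h
  simp only [zero_sub, mul_zero, add_zero] at h
  rw [h]
  congr 2
  push_cast
  ring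

/-- `jacobiTheta₂` is even, and the two shifted arguments, up to sign, differ by the period 1 + τ.
-/
theorem theta_neg_one_neg (z τ : ℂ) : theta (-1) (-1) (-z) τ = -theta (-1) (-1) z τ := by
  rw [theta_neg_one_eq_jacobiTheta₂, theta_neg_one_eq_jacobiTheta₂,
    ← jacobiTheta₂_neg_left (-z - 1 / 2 - τ / 2),
    show -(-z - 1 / 2 - τ / 2) = (z - 1 / 2 - τ / 2) + 1 + τ by ring,
    jacobiTheta₂_add_left', jacobiTheta₂_add_left, ← mul_assoc, ← Complex.exp_add,
    ← neg_mul, ← mul_neg_one (Complex.exp _), ← Complex.exp_pi_mul_I, ← Complex.exp_add]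
  congr 1
  rw [Complex.exp_eq_exp_iff_exists_int]
  exact ⟨-1, by push_cast; ring⟩

theorem Complex.cpow_half_neg_I_mul {τ : ℂ} (hτ : 0 < τ.im) :
    (-Complex.I * τ) ^ (1 / 2 : ℂ) =
      Complex.exp (-(Real.pi * Complex.I / 4)) * τ ^ (1 / 2 : ℂ) := by
  have h0 : τ ≠ 0 := by rintro rfl; simp at hτ
  rw [Complex.cpow_def_of_ne_zero (by simp [h0]), Complex.cpow_def_of_ne_zero h0,
    Complex.log_mul (by simp) h0, Complex.log_neg_I, ← Complex.exp_add]
  · congr 1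
    ring
  · rw [Complex.arg_neg_I]
    have h1 := Complex.arg_nonneg_iff.2 hτ.le
    have h2 := Complex.arg_le_pi τ
    have := Real.pi_pos
    constructor <;> linarith

theorem theta_neg_one_neg_one_div (z : ℂ) {τ : ℂ} (hτ : 0 < τ.im) :
    theta (-1) (-1) (z / τ) (-1 / τ) =
      Complex.exp (Real.pi * Complex.I * (-3 / 4)) * τ ^ (1 / 2 : ℂ) *
        Complex.exp (Real.pi * Complex.I * (z ^ 2 / τ)) * theta (-1) (-1) z τ := by
  have h0 : τ ≠ 0 := by rintro rfl; simp at hτ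
  have hs : τ ^ (1 / 2 : ℂ) ≠ 0 := by simp [Complex.cpow_eq_zero_iff, h0]
  rw [theta_neg_one_eq_jacobiTheta₂, theta_neg_one_eq_jacobiTheta₂ z τ,
    jacobiTheta₂_functional_equation (z - 1 / 2 - τ / 2) τ, Complex.cpow_half_neg_I_mul hτ,
    -- The argument produced by the functional equation is off by one quasi-period -1/τ.
    show z / τ - 1 / 2 - -1 / τ / 2 = (z / τ - 1 / 2 + -1 / τ / 2) - -1 / τ by ring]
  have h := jacobiTheta₂_add_left' ((z / τ - 1 / 2 + -1 / τ / 2) - -1 / τ) (-1 / τ)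
  rw [sub_add_cancel] at h
  rw [show (z - 1 / 2 - τ / 2) / τ = z / τ - 1 / 2 + -1 / τ / 2 by field_simp; ring, h]
  generalize jacobiTheta₂ _ _ = J
  rw [one_div (_ * _), mul_inv, ← Complex.exp_neg]
  have hS : τ ^ (1 / 2 : ℂ) * (τ ^ (1 / 2 : ℂ))⁻¹ = 1 := mul_inv_cancel₀ hs
  generalize τ ^ (1 / 2 : ℂ) = S at *
  rw [show ∀ a b c d e f : ℂ, a * S * b * (c * (d * S⁻¹ * e * (f * J))) =
    (a * b * c * d * e * f) * (S * S⁻¹) * J by intros; ring, hS, mul_one]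
  simp only [← Complex.exp_add]
  congr 1
  rw [Complex.exp_eq_exp_iff_exists_int]
  refine ⟨0, ?_⟩
  field_simp
  push_cast
  ring

/-! ### Branches of the square root. -/

theorem Complex.re_im_cpow_half_pos {w : ℂ} (hw : 0 < w.im) :
    0 < (w ^ (1 / 2 : ℂ)).re ∧ 0 < (w ^ (1 / 2 : ℂ)).im := by
  have h0 : w ≠ 0 := by rintro rfl; simp at hw
  have h1 : 0 < w.arg := by
    refine lt_of_le_of_ne (Complex.arg_nonneg_iff.2 hw.le) fun h => ?_
    exact hw.ne' (Complex.arg_eq_zero_iff.1 h.symm).2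
  have h2 : w.arg < Real.pi := by
    refine lt_of_le_of_ne (Complex.arg_le_pi w) fun h => ?_
    exact hw.ne' (Complex.arg_eq_pi_iff.1 h).2
  have e : (Complex.log w * (1 / 2)).im = w.arg / 2 := by
    rw [show Complex.log w * (1 / 2) = Complex.log w / (2 : ℝ) by push_cast; ring,
      Complex.div_ofReal_im, Complex.log_im]
  rw [Complex.cpow_def_of_ne_zero h0, Complex.exp_re, Complex.exp_im, e]
  exact ⟨mul_pos (Real.exp_pos _) (Real.cos_pos_of_mem_Ioo ⟨by linarith, by linarith⟩),
    mul_pos (Real.exp_pos _) (Real.sin_pos_of_pos_of_lt_pi (by linarith) (by linarith))⟩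

/-- The squares agree. The sign is forced because all three roots lie in the open first quadrant, so
both sides have positive imaginary part. -/
theorem Complex.cpow_half_mul_cpow_half {u v w : ℂ} (hu : 0 < u.im) (hv : 0 < v.im)
    (hw : 0 < w.im) (h : u * v = -w) :
    u ^ (1 / 2 : ℂ) * v ^ (1 / 2 : ℂ) = Complex.I * w ^ (1 / 2 : ℂ) := by
  obtain ⟨ur, ui⟩ := Complex.re_im_cpow_half_pos hu
  obtain ⟨vr, vi⟩ := Complex.re_im_cpow_half_pos hv
  obtain ⟨wr, wi⟩ := Complex.re_im_cpow_half_pos hw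
  have sq (x : ℂ) : (x ^ (1 / 2 : ℂ)) ^ 2 = x := by
    rw [one_div]; exact Complex.cpow_nat_inv_pow x two_ne_zero
  have hs : (u ^ (1 / 2 : ℂ) * v ^ (1 / 2 : ℂ)) ^ 2 = (Complex.I * w ^ (1 / 2 : ℂ)) ^ 2 := by
    rw [mul_pow, mul_pow, sq, sq, sq, Complex.I_sq, h]; ring
  rcases sq_eq_sq_iff_eq_or_eq_neg.1 hs with h | h
  · exact h
  · have := congrArg Complex.im h
    simp only [Complex.mul_im, Complex.neg_im, Complex.I_re, Complex.I_im] at this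
    nlinarith [mul_pos ur vi, mul_pos ui vr]

/-! ### Dedekind sums and reciprocity. -/

/-- The sum `∑_{0 ≤ k < c} k (d k mod c)`, an integral form of the Dedekind sum. -/
def residueSum (d : ℤ) (c : ℕ) : ℤ := ∑ k ∈ Finset.range c, (k : ℤ) * (d * k % c)

theorem residueSum_add_mul (d n : ℤ) (c : ℕ) : residueSum (d + n * c) c = residueSum d c := by
  refine Finset.sum_congr rfl fun k _ => ?_
  rw [show (d + n * c) * k = d * k + c * (n * k) by ring, Int.add_mul_emod_self_left]

theorem sum_range_cast_int (c : ℕ) : 2 * ∑ k ∈ Finset.range c, (k : ℤ) = c * (c - 1) := by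
  induction c with
  | zero => simp
  | succ c ih => rw [Finset.sum_range_succ, mul_add, ih]; push_cast; ring

theorem sum_range_sq_cast_int (c : ℕ) :
    6 * ∑ k ∈ Finset.range c, (k : ℤ) ^ 2 = c * (c - 1) * (2 * c - 1) := by
  induction c with
  | zero => simp
  | succ c ih => rw [Finset.sum_range_succ, mul_add, ih]; push_cast; ring

theorem not_dvd_mul_of_mem_range {d : ℤ} {c k : ℕ} (h : IsCoprime d (c : ℤ)) (hk : k < c)
    (hk0 : k ≠ 0) : ¬ (c : ℤ) ∣ d * k := fun hd => by
  have := Int.le_of_dvd (by positivity) (h.symm.dvd_of_dvd_mul_left hd)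
  omega

/-- For 0 < k < c the residues of dk and -dk add up to c. -/
theorem residueSum_neg {d : ℤ} {c : ℕ} (h : IsCoprime d (c : ℤ)) :
    2 * residueSum (-d) c = c ^ 2 * (c - 1) - 2 * residueSum d c := by
  have : residueSum (-d) c = ∑ k ∈ Finset.range c, ((k : ℤ) * c - k * (d * k % c)) := by
    refine Finset.sum_congr rfl fun k hk => ?_
    rcases eq_or_ne k 0 with rfl | hk0
    · simp
    · have hn := not_dvd_mul_of_mem_range h (Finset.mem_range.1 hk) hk0
      rw [neg_mul, Int.neg_emod, if_neg hn]
      simp only [Int.natAbs_natCast]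
      ring
  rw [this, Finset.sum_sub_distrib, ← Finset.sum_mul, mul_sub, ← mul_assoc, sum_range_cast_int,
    residueSum]
  ring

/-- Multiplication by a unit permutes the residues modulo c. -/
theorem sum_comp_mul_emod {d : ℤ} {c : ℕ} (h : IsCoprime d (c : ℤ)) (f : ℤ → ℤ) :
    ∑ k ∈ Finset.range c, f (d * k % c) = ∑ k ∈ Finset.range c, f k := by
  rcases Nat.eq_zero_or_pos c with rfl | hc
  · simp
  have hc' : (0 : ℤ) < c := by exact_mod_cast hc
  have hnn (k : ℕ) : 0 ≤ d * k % c := Int.emod_nonneg _ hc'.ne'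
  have hmaps : ∀ k ∈ Finset.range c, (d * (k : ℤ) % c).toNat ∈ Finset.range c := fun k _ => by
    have := Int.emod_lt_of_pos (d * k) hc'
    have := hnn k
    simp only [Finset.mem_range]
    omega
  have hinj : Set.InjOn (fun k : ℕ => (d * (k : ℤ) % c).toNat) (Finset.range c) := by
    intro k hk l hl hkl
    have hkl' : d * (k : ℤ) % c = d * l % c := by
      have := hnn k
      have := hnn l
      dsimp only at hkl
      omega
    have h2 : (c : ℤ) ∣ d * (l - k) := by
      rw [mul_sub]; exact Int.ModEq.dvd hkl'
    have h3 := h.symm.dvd_of_dvd_mul_left h2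
    have hk' := Finset.mem_range.1 (Finset.mem_coe.1 hk)
    have hl' := Finset.mem_range.1 (Finset.mem_coe.1 hl)
    have h4 := Int.eq_zero_of_abs_lt_dvd h3 (abs_lt.2 ⟨by omega, by omega⟩)
    omega
  refine Finset.sum_nbij (fun k : ℕ => (d * (k : ℤ) % c).toNat) hmaps hinj
    (Finset.surjOn_of_injOn_of_card_le _ hmaps hinj le_rfl) fun k _ => ?_
  rw [Int.toNat_of_nonneg (hnn k)]

theorem sum_mul_div_eq (d : ℤ) (c : ℕ) :
    c * ∑ k ∈ Finset.range c, (k : ℤ) * (d * k / c) =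
      d * ∑ k ∈ Finset.range c, (k : ℤ) ^ 2 - residueSum d c := by
  rw [residueSum, Finset.mul_sum, Finset.mul_sum, ← Finset.sum_sub_distrib]
  refine Finset.sum_congr rfl fun k _ => ?_
  linear_combination (k : ℤ) * Int.mul_ediv_add_emod (d * k) c

theorem sum_div_eq {d : ℤ} {c : ℕ} (h : IsCoprime d (c : ℤ)) :
    c * ∑ k ∈ Finset.range c, (d * k / c : ℤ) = (d - 1) * ∑ k ∈ Finset.range c, (k : ℤ) := by
  have hs := sum_comp_mul_emod h fun x => x
  have : c * ∑ k ∈ Finset.range c, (d * k / c : ℤ) =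
      d * ∑ k ∈ Finset.range c, (k : ℤ) - ∑ k ∈ Finset.range c, (d * k % c : ℤ) := by
    rw [Finset.mul_sum, Finset.mul_sum, ← Finset.sum_sub_distrib]
    refine Finset.sum_congr rfl fun k _ => ?_
    linear_combination Int.mul_ediv_add_emod (d * k) c
  linear_combination this - hs

theorem sum_div_sq_eq {d : ℤ} {c : ℕ} (h : IsCoprime d (c : ℤ)) :
    c ^ 2 * ∑ k ∈ Finset.range c, (d * k / c : ℤ) ^ 2 =
      (d ^ 2 + 1) * ∑ k ∈ Finset.range c, (k : ℤ) ^ 2 - 2 * d * residueSum d c := by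
  have hs := sum_comp_mul_emod h fun x => x ^ 2
  have : c ^ 2 * ∑ k ∈ Finset.range c, (d * k / c : ℤ) ^ 2 =
      d ^ 2 * ∑ k ∈ Finset.range c, (k : ℤ) ^ 2 + ∑ k ∈ Finset.range c, (d * k % c : ℤ) ^ 2
        - 2 * d * residueSum d c := by
    rw [residueSum, Finset.mul_sum, Finset.mul_sum, Finset.mul_sum, ← Finset.sum_add_distrib,
      ← Finset.sum_sub_distrib]
    refine Finset.sum_congr rfl fun k _ => ?_
    have e : (c : ℤ) * (d * k / c) = d * k - d * k % c := by
      linear_combination Int.mul_ediv_add_emod (d * k) c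
    rw [← mul_pow, e]
    ring
  linear_combination this + hs

/-- Counting lattice points below the diagonal of a rectangle in two ways. -/
theorem sum_div_mul_div_add_one {c d : ℕ} (h : Nat.Coprime d c) (hc : 0 < c) (hd : 0 < d) :
    ∑ k ∈ Finset.range c, ((d * k / c : ℕ) : ℤ) * ((d * k / c : ℕ) + 1) =
      2 * ∑ j ∈ Finset.range d, (j : ℤ) * (c - 1 - (c * j / d : ℕ)) := by
  have h1 (k : ℕ) (hk : k < c) : ((d * k / c : ℕ) : ℤ) * ((d * k / c : ℕ) + 1) =
      2 * ∑ j ∈ Finset.range d, if j ≤ d * k / c then (j : ℤ) else 0 := by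
    have hlt : d * k / c < d := Nat.div_lt_of_lt_mul (by nlinarith)
    rw [← Finset.sum_filter, show Finset.filter (· ≤ d * k / c) (Finset.range d) =
      Finset.range (d * k / c + 1) by ext; simp; omega, sum_range_cast_int]
    push_cast
    ring
  rw [Finset.sum_congr rfl fun k hk => h1 k (Finset.mem_range.1 hk), ← Finset.mul_sum,
    Finset.sum_comm]
  congr 1
  refine Finset.sum_congr rfl fun j hj => ?_
  rcases eq_or_ne j 0 with rfl | hj0
  · simp
  have hj := Finset.mem_range.1 hj
  have hlt : c * j / d < c := Nat.div_lt_of_lt_mul (by nlinarith)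
  have h2 : Finset.filter (fun k => j ≤ d * k / c) (Finset.range c) =
      Finset.Ioo (c * j / d) c := by
    ext k
    simp only [Finset.mem_filter, Finset.mem_range, Finset.mem_Ioo]
    rw [and_comm, Nat.le_div_iff_mul_le hc, Nat.div_lt_iff_lt_mul hd]
    refine and_congr_left fun hk => ⟨fun hle => ?_, fun hlt => ?_⟩
    -- No lattice point lies on the diagonal: cj = dk would force d ∣ j, with 0 < j < d.
    · refine lt_of_le_of_ne (by linarith) fun he => ?_
      have : d ∣ j := h.dvd_of_dvd_mul_left ⟨k, by linarith⟩
      exact absurd (Nat.le_of_dvd (by omega) this) (by omega)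
    · linarith
  rw [← Finset.sum_filter, h2, Finset.sum_const, Nat.card_Ioo, nsmul_eq_mul]
  rw [Nat.sub_sub, Nat.cast_sub (by omega)]
  push_cast
  ring

/-- Reciprocity for Dedekind sums. -/
theorem residueSum_reciprocity {c d : ℕ} (h : Nat.Coprime d c) (hc : 0 < c) (hd : 0 < d) :
    12 * ((d : ℤ) ^ 2 * residueSum d c + c ^ 2 * residueSum c d) =
      3 * c ^ 2 * d ^ 2 * (c + d - 3) + c * d * (c ^ 2 + d ^ 2 + 1) := by
  have hi : IsCoprime (d : ℤ) (c : ℤ) := Nat.isCoprime_iff_coprime.2 h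
  have e1 := sum_div_mul_div_add_one h hc hd
  have e2 := sum_div_sq_eq hi
  have e3 := sum_div_eq hi
  have e4 := sum_mul_div_eq (c : ℤ) d
  have s1 := sum_range_cast_int c
  have s2 := sum_range_sq_cast_int c
  have t1 := sum_range_cast_int d
  have t2 := sum_range_sq_cast_int d
  push_cast at e1
  simp only [mul_add, mul_sub, mul_one, Finset.sum_add_distrib, Finset.sum_sub_distrib,
    ← Finset.sum_mul, ← sq] at e1
  -- `e2` brings in `residueSum d c` through squared quotients, `e4` brings in `residueSum c d`, and
  -- the lattice count `e1` links them; the rest is power sums.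
  linear_combination 6 * d * e2 + 12 * c ^ 2 * e4 - 6 * d * c ^ 2 * e1 + 6 * d * c * e3
    + d * (d ^ 2 + 1) * s2 + 2 * c ^ 3 * t2 - 6 * d * c ^ 2 * (c - 1) * t1
    + 3 * d * c * (d - 1) * s1

/-! ### The multiplier exponent in terms of residues. -/

theorem integerPart_neg (x : ℚ) : integerPart (-x) = -integerPart x := by
  rcases lt_trichotomy x 0 with h | rfl | h
  · rw [integerPart, integerPart, if_pos (by linarith), if_neg (by linarith), Int.floor_neg]
  · simp [integerPart]
  · rw [integerPart, integerPart, if_neg (by linarith), if_pos h.le, Int.ceil_neg]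

theorem integerPart_eq_zero {x : ℚ} (h : |x| < 1) : integerPart x = 0 := by
  obtain ⟨h1, h2⟩ := abs_lt.1 h
  rw [integerPart]
  split_ifs with h0
  · exact Int.floor_eq_zero_iff.2 ⟨h0, h2⟩
  · exact Int.ceil_eq_zero_iff.2 ⟨h1, (not_le.1 h0).le⟩

theorem integerPart_mul_of_nonneg {d : ℤ} (hd : 0 ≤ d) (c k : ℕ) :
    integerPart ((d : ℚ) / (c : ℚ) * (k : ℚ)) = d * k / c := by
  have hd' : (0 : ℚ) ≤ d := by exact_mod_cast hd
  rw [integerPart, if_pos (by positivity), ← Rat.floor_intCast_div_natCast]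
  congr 1
  push_cast
  ring

theorem integerPart_mul_of_nonpos {d : ℤ} (hd : d ≤ 0) (c k : ℕ) :
    integerPart ((d : ℚ) / (c : ℚ) * (k : ℚ)) = -(-d * k / c) := by
  rw [← integerPart_mul_of_nonneg (by omega : 0 ≤ -d), ← integerPart_neg]
  congr 1
  push_cast
  ring

theorem sum_Ico_zero_cast (c : ℕ) (g : ℤ → ℤ) :
    ∑ k ∈ Finset.Ico (0 : ℤ) c, g k = ∑ k ∈ Finset.range c, g k := by
  refine Finset.sum_nbij' Int.toNat (fun k => (k : ℤ)) ?_ ?_ ?_ ?_ ?_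
  · intro k hk
    simp only [Finset.mem_Ico, Finset.mem_range] at *
    omega
  · intro k hk
    simp only [Finset.mem_Ico, Finset.mem_range] at *
    omega
  · intro k hk
    exact Int.toNat_of_nonneg (Finset.mem_Ico.1 hk).1
  · intro k _
    exact Int.toNat_natCast k
  · intro k hk
    rw [Int.toNat_of_nonneg (Finset.mem_Ico.1 hk).1]

/-- The two ranges differ only in indices with k = 0 or |dk| < c, whose terms vanish. The boundary
case dk = c is excluded by coprimality. -/
theorem dedekindTypeSum_eq_sum_range {d : ℤ} {c : ℕ} (hc : 0 < c) (h : IsCoprime d (c : ℤ)) :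
    dedekindTypeSum c d =
      ∑ k ∈ Finset.range c, integerPart ((d : ℚ) / (c : ℚ) * (k : ℚ)) * k := by
  have hr := sum_Ico_zero_cast c fun k => integerPart ((d : ℚ) / ((c : ℤ) : ℚ) * (k : ℚ)) * k
  simp only [Int.cast_natCast] at hr
  rw [dedekindTypeSum, ← hr]
  simp only [Int.cast_natCast]
  have hcq : (0 : ℚ) < c := by exact_mod_cast hc
  have hsmall {k : ℤ} (hk : |d * k| < c) : integerPart ((d : ℚ) / (c : ℚ) * (k : ℚ)) = 0 := by
    refine integerPart_eq_zero ?_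
    rw [div_mul_eq_mul_div, abs_div, abs_of_pos hcq, div_lt_one hcq]
    exact_mod_cast hk
  rcases lt_trichotomy d 0 with hd | rfl | hd
  · have hdq : (d : ℚ) < 0 := by exact_mod_cast hd
    have hf : ⌊(c : ℚ) / d⌋ < 0 := by
      rw [Int.floor_lt]
      exact_mod_cast div_neg_of_pos_of_neg hcq hdq
    symm
    refine Finset.sum_subset (fun k hk => ?_) fun k hk hk' => ?_
    · simp only [Finset.mem_Ico, Finset.mem_Icc] at *
      omega
    · simp only [Finset.mem_Ico, Finset.mem_Icc] at *
      have hk0 : k < 0 := by omega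
      have h1 := Int.floor_lt.1 (by omega : ⌊(c : ℚ) / d⌋ < k)
      rw [div_lt_iff_of_neg hdq] at h1
      have h2 : k * d < c := by exact_mod_cast h1
      rw [hsmall, zero_mul]
      rw [abs_of_pos (mul_pos_of_neg_of_neg hd hk0)]
      linarith
  · simp [integerPart]
  · have hdq : (0 : ℚ) < d := by exact_mod_cast hd
    have hf : 0 ≤ ⌊(c : ℚ) / d⌋ := Int.floor_nonneg.2 (by positivity)
    refine Finset.sum_subset (fun k hk => ?_) fun k hk hk' => ?_
    · simp only [Finset.mem_Ico, Finset.mem_Icc] at *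
      omega
    · simp only [Finset.mem_Ico, Finset.mem_Icc] at *
      rcases eq_or_ne k 0 with rfl | hk0
      · simp
      have h1 := Int.le_floor.1 (by omega : k ≤ ⌊(c : ℚ) / d⌋)
      rw [le_div_iff₀ hdq] at h1
      have h2 : k * d ≤ c := by exact_mod_cast h1
      rw [hsmall, zero_mul]
      rw [abs_of_nonneg (mul_nonneg hd.le hk.1)]
      refine lt_of_le_of_ne (by linarith) fun he => ?_
      refine not_dvd_mul_of_mem_range (k := k.toNat) h (by omega) (by omega) ?_
      rw [Int.toNat_of_nonneg hk.1, he]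

/-- Rounding towards zero is odd, so d < 0 reduces to -d; the sign term compensates for the
reflection in `residueSum_neg`, leaving one formula for all signs. -/
theorem multiplierExponent_eq (a : ℤ) {d : ℤ} {c : ℕ} (hc : 0 < c) (h : IsCoprime d (c : ℤ)) :
    multiplierExponent a c d =
      ((a : ℚ) + d) / (12 * c) - residueSum d c / c ^ 2 + (c - 1) / 4 - 1 / 4 := by
  have hcq : (c : ℚ) ≠ 0 := by exact_mod_cast hc.ne'
  have s2 : 6 * ((∑ k ∈ Finset.range c, (k : ℤ) ^ 2 : ℤ) : ℚ) = c * (c - 1) * (2 * c - 1) := by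
    exact_mod_cast congrArg (Int.cast : ℤ → ℚ) (sum_range_sq_cast_int c)
  rw [multiplierExponent, dedekindTypeSum_eq_sum_range hc h]
  rcases lt_trichotomy d 0 with hd | rfl | hd
  · have e : ∑ k ∈ Finset.range c, integerPart ((d : ℚ) / (c : ℚ) * (k : ℚ)) * k =
        -∑ k ∈ Finset.range c, (k : ℤ) * (-d * k / c) := by
      rw [← Finset.sum_neg_distrib]
      refine Finset.sum_congr rfl fun k _ => ?_
      rw [integerPart_mul_of_nonpos hd.le]
      ring
    have e1 := sum_mul_div_eq (-d) c
    have e2 := residueSum_neg h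
    rw [e, Int.sign_eq_neg_one_of_neg hd]
    generalize ∑ k ∈ Finset.range c, (k : ℤ) * (-d * k / c) = G at *
    generalize ∑ k ∈ Finset.range c, (k : ℤ) ^ 2 = S at *
    have e1' : (c : ℚ) * G = -d * S - residueSum (-d) c := by exact_mod_cast e1
    have e2' : 2 * (residueSum (-d) c : ℚ) = c ^ 2 * (c - 1) - 2 * residueSum d c := by
      exact_mod_cast e2
    have hG : (G : ℚ) = -(d * S + residueSum (-d) c) / c := by
      field_simp; linear_combination e1'
    have hB : (residueSum (-d) c : ℚ) = c ^ 2 * (c - 1) / 2 - residueSum d c := by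
      linear_combination e2' / 2
    have hS : (S : ℚ) = c * (c - 1) * (2 * c - 1) / 6 := by linear_combination s2 / 6
    push_cast
    rw [hG, hB, hS]
    field_simp
    ring
  · have : c = 1 := by
      have := Int.isUnit_iff.1 (isCoprime_zero_left.1 h)
      omega
    subst this
    simp [integerPart, residueSum]
  · have e : ∑ k ∈ Finset.range c, integerPart ((d : ℚ) / (c : ℚ) * (k : ℚ)) * k =
        ∑ k ∈ Finset.range c, (k : ℤ) * (d * k / c) := by
      refine Finset.sum_congr rfl fun k _ => ?_
      rw [integerPart_mul_of_nonneg hd.le]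
      ring
    have e1 := sum_mul_div_eq d c
    rw [e, Int.sign_eq_one_of_pos hd]
    generalize ∑ k ∈ Finset.range c, (k : ℤ) * (d * k / c) = G at *
    generalize ∑ k ∈ Finset.range c, (k : ℤ) ^ 2 = S at *
    have e1' : (c : ℚ) * G = d * S - residueSum d c := by exact_mod_cast e1
    have hG : (G : ℚ) = (d * S - residueSum d c) / c := by
      field_simp; linear_combination e1'
    have hS : (S : ℚ) = c * (c - 1) * (2 * c - 1) / 6 := by linear_combination s2 / 6
    push_cast
    rw [hG, hS]
    field_simp
    ring

/-! ### The modular transformation law. -/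

theorem im_intCast_mul_add_pos {c : ℤ} (hc : 0 < c) (d : ℤ) {τ : ℂ} (hτ : 0 < τ.im) :
    0 < (c * τ + d : ℂ).im := by
  have : (0 : ℝ) < c := by exact_mod_cast hc
  simp only [Complex.add_im, Complex.mul_im, Complex.intCast_re, Complex.intCast_im]
  nlinarith

/-- The transformation law of `θ[-1, -1]` under a modular substitution. -/
theorem theta_neg_one_modular (c : ℕ) (hc : 0 < c) (a b d : ℤ) (hdet : a * d - b * c = 1)
    (z τ : ℂ) (hτ : 0 < τ.im) :
    theta (-1) (-1) (z / (c * τ + d)) ((a * τ + b) / (c * τ + d)) =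
      Complex.exp (Real.pi * Complex.I *
          ((a + d) / (4 * c) - 3 * residueSum d c / c ^ 2 + 3 * (c - 1) / 4 - 3 / 4)) *
        (c * τ + d) ^ (1 / 2 : ℂ) * Complex.exp (Real.pi * Complex.I * (c * z ^ 2 / (c * τ + d))) *
        theta (-1) (-1) z τ := by
  induction c using Nat.strong_induction_on generalizing a b d z τ with
  | _ c ih =>
  have hcz : (0 : ℤ) < c := by exact_mod_cast hc
  have hcC : (c : ℂ) ≠ 0 := by exact_mod_cast hc.ne'
  -- Reduction to `0 ≤ d < c` by a translation of `τ`.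
  wlog hd : 0 ≤ d ∧ d < c generalizing b d τ
  · have key := this (b - a * (d / c)) (d % c)
      (by linear_combination hdet + a * Int.mul_ediv_add_emod d c) (τ + (d / c : ℤ))
      (by simpa using hτ) ⟨Int.emod_nonneg _ hcz.ne', Int.emod_lt_of_pos _ hcz⟩
    have hdm : (d : ℂ) = c * (d / c : ℤ) + (d % c : ℤ) := by
      exact_mod_cast (Int.mul_ediv_add_emod d c).symm
    have hB : residueSum d c = residueSum (d % c) c := by
      rw [← residueSum_add_mul (d % c) (d / c), mul_comm, Int.emod_add_mul_ediv]
    rw [hB]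
    push_cast at key ⊢
    generalize (d / c : ℤ) = q at *
    generalize (d % c : ℤ) = r at *
    rw [hdm]
    rw [theta_neg_one_add_int, show (c : ℂ) * (τ + q) + r = c * τ + (c * q + r) by ring,
      show (a : ℂ) * (τ + q) + (b - a * q) = a * τ + b by ring] at key
    rw [key, show (Real.pi * Complex.I * ((a + (c * q + r)) / (4 * c) -
        3 * residueSum r c / c ^ 2 + 3 * (c - 1) / 4 - 3 / 4) : ℂ) =
      Real.pi * Complex.I * ((a + r) / (4 * c) - 3 * residueSum r c / c ^ 2 +
        3 * (c - 1) / 4 - 3 / 4) + Real.pi * Complex.I * (q / 4) by field_simp; ring,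
      Complex.exp_add]
    ring
  obtain ⟨hd0, hdc⟩ := hd
  rcases hd0.eq_or_lt with rfl | hd0
  · have hc1 : c = 1 := by
      have : (c : ℤ) ∣ 1 := ⟨-b, by linear_combination -hdet⟩
      have := Int.le_of_dvd one_pos this
      omega
    subst hc1
    have hb : b = -1 := by simpa using congrArg Neg.neg hdet
    subst hb
    have hτ0 : τ ≠ 0 := by rintro rfl; simp at hτ
    have e : (a * τ + (-1 : ℤ)) / ((1 : ℕ) * τ + (0 : ℤ)) = -1 / τ + (a : ℂ) := by
      push_cast
      rw [one_mul, add_zero]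
      field_simp
      ring
    rw [e, theta_neg_one_add_int]
    have h := theta_neg_one_neg_one_div z hτ
    have hr : residueSum 0 1 = 0 := by simp [residueSum]
    rw [hr]
    push_cast
    rw [one_mul, add_zero, h, one_mul, show (Real.pi * Complex.I *
      ((a + 0) / (4 * 1) - 3 * 0 / 1 ^ 2 + 3 * (1 - 1) / 4 - 3 / 4) : ℂ) =
      Real.pi * Complex.I * (a / 4) + Real.pi * Complex.I * (-3 / 4) by ring, Complex.exp_add]
    ring
  · lift d to ℕ using hd0.le
    have hdn : 0 < d := by exact_mod_cast hd0
    have hdC : (d : ℂ) ≠ 0 := by exact_mod_cast hdn.ne'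
    have hcop : IsCoprime (c : ℤ) (d : ℤ) := ⟨-b, a, by linear_combination hdet⟩
    have hτ0 : τ ≠ 0 := by rintro rfl; simp at hτ
    have hτ1 : 0 < (-1 / τ).im := by
      rw [neg_div, one_div, Complex.neg_im, Complex.inv_im, neg_div, neg_neg]
      exact div_pos hτ (Complex.normSq_pos.2 hτ0)
    have hw : 0 < (c * τ + (d : ℤ) : ℂ).im := im_intCast_mul_add_pos hcz d hτ
    have hw1 : 0 < (d * (-1 / τ) + (-c : ℤ) : ℂ).im := im_intCast_mul_add_pos hd0 (-c) hτ1
    have hw0 : (c * τ + (d : ℤ) : ℂ) ≠ 0 := fun h => by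
      rw [h] at hw
      exact lt_irrefl _ hw
    -- Composing (b, -a; d, -c) with τ ↦ -1/τ gives minus the original matrix: the same action on τ,
    -- and the sign is absorbed by taking -z/τ.
    have key := ih d (by exact_mod_cast hdc) hdn b (-a) (-c) (by linear_combination hdet)
      (-(z / τ)) (-1 / τ) hτ1
    have hww : (d * (-1 / τ) + (-c : ℤ) : ℂ) = -(c * τ + (d : ℤ)) / τ := by
      push_cast
      field_simp
      ring
    have hroot := Complex.cpow_half_mul_cpow_half hw1 hτ hw (by rw [hww]; field_simp)
    have e1 : -(z / τ) / (d * (-1 / τ) + (-c : ℤ) : ℂ) = z / (c * τ + (d : ℤ)) := by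
      rw [hww]; field_simp
    have e2 : (b * (-1 / τ) + (-a : ℤ)) / (d * (-1 / τ) + (-c : ℤ) : ℂ) =
        (a * τ + b) / (c * τ + (d : ℤ)) := by
      rw [hww]; push_cast; field_simp; ring
    rw [e1, e2, theta_neg_one_neg, theta_neg_one_neg_one_div z hτ] at key
    have hrec : 12 * ((d : ℂ) ^ 2 * residueSum d c + c ^ 2 * residueSum c d) =
        3 * c ^ 2 * d ^ 2 * (c + d - 3) + c * d * (c ^ 2 + d ^ 2 + 1) := by
      exact_mod_cast congrArg (Int.cast : ℤ → ℂ)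
        (residueSum_reciprocity (Nat.isCoprime_iff_coprime.1 hcop).symm hc hdn)
    have hneg : 2 * (residueSum (-c) d : ℂ) = d ^ 2 * (d - 1) - 2 * residueSum c d := by
      exact_mod_cast congrArg (Int.cast : ℤ → ℂ) (residueSum_neg hcop)
    have hdetC : (a : ℂ) * d - b * c = 1 := by exact_mod_cast hdet
    -- The extra phases are -3πi/4 from the inversion, πi from oddness and πi/2 from the factor I in
    -- `hroot`.
    have hphase : (Real.pi * Complex.I * ((b + (-c : ℤ)) / (4 * d) -
          3 * residueSum (-c) d / d ^ 2 + 3 * (d - 1) / 4 - 3 / 4) : ℂ) +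
        Real.pi * Complex.I * (-3 / 4) + Real.pi * Complex.I + Real.pi / 2 * Complex.I =
        Real.pi * Complex.I * ((a + (d : ℤ)) / (4 * c) - 3 * residueSum d c / c ^ 2 +
          3 * (c - 1) / 4 - 3 / 4) := by
      rw [show (residueSum (-c) d : ℂ) = d ^ 2 * (d - 1) / 2 - residueSum c d by
        linear_combination hneg / 2]
      push_cast
      field_simp
      linear_combination 2 * hrec - 2 * c * d * hdetC
    have hquad : (Real.pi * Complex.I * (d * (-(z / τ)) ^ 2 / (d * (-1 / τ) + (-c : ℤ))) : ℂ) +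
        Real.pi * Complex.I * (z ^ 2 / τ) =
        Real.pi * Complex.I * (c * z ^ 2 / (c * τ + (d : ℤ))) := by
      rw [hww]
      have hd' : (d : ℂ) = (c * τ + (d : ℤ)) - c * τ := by push_cast; ring
      generalize (c * τ + (d : ℤ) : ℂ) = w at *
      rw [hd']
      field_simp
      ring
    rw [key, ← hphase, ← hquad]
    simp only [Complex.exp_add, Complex.exp_pi_mul_I, Complex.exp_pi_div_two_mul_I]
    generalize Complex.exp (Real.pi * Complex.I * ((b + (-c : ℤ)) / (4 * d) -
      3 * residueSum (-c) d / d ^ 2 + 3 * (d - 1) / 4 - 3 / 4)) = A₁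
    generalize Complex.exp (Real.pi * Complex.I * (-3 / 4)) = A₂
    generalize Complex.exp (Real.pi * Complex.I * (z ^ 2 / τ)) = A₃
    generalize Complex.exp (Real.pi * Complex.I *
      (d * (-(z / τ)) ^ 2 / (d * (-1 / τ) + (-c : ℤ)))) = A₄
    linear_combination (-(A₁ * A₂ * A₃ * A₄ * theta (-1) (-1) z τ)) * hroot

theorem theta_modular (a b c d : ℤ) (hdet : a * d - b * c = 1) (hc : 0 < c) (α β : ℤ) (z τ : ℂ)
    (hτ : 0 < τ.im) :
    theta (d * α - c * β - 1) (-b * α + a * β - 1) (z / (c * τ + d))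
        ((a * τ + b) / (c * τ + d)) =
      multiplierE a b c d α β * multiplierN a c d ^ 3 * ((c : ℂ) * τ + d) ^ (1 / 2 : ℂ) *
        Complex.exp (Real.pi * Complex.I * c * z ^ 2 / (c * τ + d)) *
        theta (α - 1) (β - 1) z τ := by
  lift c to ℕ using hc.le
  have hw := im_intCast_mul_add_pos hc d hτ
  have hw0 : (c * τ + d : ℂ) ≠ 0 := fun h => by
    rw [Int.cast_natCast, h] at hw
    simp at hw
  have hcn : 0 < c := by exact_mod_cast hc
  have hdetC : (a : ℂ) * d - b * c = 1 := by exact_mod_cast hdet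
  have key := theta_neg_one_modular c hcn a b d hdet (z + α * τ / 2 + β / 2) τ hτ
  have hN : multiplierN a c d ^ 3 = Complex.exp (Real.pi * Complex.I *
      ((a + d) / (4 * c) - 3 * residueSum d c / c ^ 2 + 3 * (c - 1) / 4 - 3 / 4)) := by
    have hcop : IsCoprime d (c : ℤ) := ⟨a, -b, by linear_combination hdet⟩
    rw [multiplierN, multiplierExponent_eq a hcn hcop, ← Complex.exp_nat_mul]
    congr 1
    push_cast
    field_simp
    ring
  rw [theta_eq_exp_mul_theta_neg_one (d * α - c * β), theta_eq_exp_mul_theta_neg_one α β, hN,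
    multiplierE]
  -- This is where the linear rule for the characteristics comes from: the half-period shift is
  -- carried to the new lattice.
  have harg : z / ((c : ℤ) * τ + d) + ((d * α - c * β : ℤ) : ℂ) *
      ((a * τ + b) / ((c : ℤ) * τ + d)) / 2 + ((-b * α + a * β : ℤ) : ℂ) / 2 =
      (z + α * τ / 2 + β / 2) / (c * τ + d) := by
    push_cast
    field_simp
    linear_combination (α * τ + β) * hdetC
  rw [harg]
  push_cast at key ⊢
  rw [key]
  generalize theta _ _ _ _ = θ
  generalize (c * τ + d : ℂ) ^ (1 / 2 : ℂ) = S
  generalize Complex.exp (Real.pi * Complex.I *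
      ((a + d) / (4 * c) - 3 * residueSum d c / c ^ 2 + 3 * (c - 1) / 4 - 3 / 4)) = P
  rw [show ∀ A B : ℂ, A * (P * S * B * θ) = A * B * (P * S * θ) by intros; ring]
  rw [show ∀ A B C : ℂ, A * P * S * B * (C * θ) = A * B * C * (P * S * θ) by intros; ring]
  congr 1
  simp only [← Complex.exp_add]
  congr 1
  field_simp
  linear_combination 4 * (d * τ * α ^ 2 - c * β ^ 2 + 2 * d * α * β) * hdetC

theorem theorem6p3 (α β : ℤ) (z τ : ℂ) (hτ : 0 < τ.im) :
    (∀ n : ℤ,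
      theta (α - 1) (β - 1) z (τ + n) =
        Complex.I ^ ((n : ℂ) / 2 * (1 - (α : ℂ) ^ 2)) * theta (α - 1) (β + n * α - 1) z τ) ∧
    (∀ a b c d : ℤ, a * d - b * c = 1 → 0 < c →
      ∀ α' β' : ℤ, α' = d * α - c * β → β' = -b * α + a * β →
        (α = a * α' + c * β' ∧ β = b * α' + d * β') ∧
        theta (α' - 1) (β' - 1) (z / (c * τ + d)) ((a * τ + b) / (c * τ + d)) =
          multiplierE a b c d α β * multiplierN a c d ^ 3 * ((c : ℂ) * τ + d) ^ (1 / 2 : ℂ) *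
            Complex.exp (Real.pi * Complex.I * c * z ^ 2 / (c * τ + d)) *
            theta (α - 1) (β - 1) z τ) := by
  refine ⟨fun n => theta_add_int α β n z τ, fun a b c d hdet hc α' β' hα hβ => ⟨⟨?_, ?_⟩, ?_⟩⟩
  · subst hα hβ
    linear_combination (-α) * hdet
  · subst hα hβ
    linear_combination (-β) * hdet
  · subst hα hβ
    exact theta_modular a b c d hdet hc α β z τ hτ
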